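/- Let $d\ge 2$ and $0<r\le\frac{\pi}{2}$. Let $\mathbb{S}^d$ be the unit sphere of $\mathbb{R}^{d+1}$ with the spherical (angular) distance ${\rm dist}_s$, the spherical diameter ${\rm diam}_s(X)=\sup\{{\rm dist}_s(\mathbf{x},\mathbf{y}) : \mathbf{x},\mathbf{y}\in X\}$ and the $d$-dimensional spherical volume ${\rm vol}_s$. For $X\subseteq\mathbb{S}^d$ put $\mathbf{B}_s^d[X,r]=\{\mathbf{y}\in\mathbb{S}^d : {\rm dist}_s(\mathbf{x},\mathbf{y})\le r \text{ for all } \mathbf{x}\in X\}$. A wide $r$-ball body is a set of the form $\mathbf{B}_s^d[X,r]$ with $X\subseteq\mathbb{S}^d$ nonempty, closed and of spherical diameter ${\rm diam}_s(X)\le r$. A convex body of constant width $r$ is a closed set $\mathbf{K}\subset\mathbb{S}^d$ with ${\rm diam}_s(\mathbf{K})=r$ and $\mathbf{K}=\mathbf{B}_s^d[\mathbf{K},r]$. Then: (i) every wide $r$-ball body contains a convex body of constant width $r$; (ii) the infimum $c_{BL}(r,d)$ of the volumes ${\rm vol}_s(\mathbf{W})$ of all wide $r$-ball bodies $\mathbf{W}\subset\mathbb{S}^d$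 is equal to the minimum of the volumes of the convex bodies of constant width $r$ in $\mathbb{S}^d$; in particular this minimum is attained: $$c_{BL}(r,d)=\min\{{\rm vol}_s(\mathbf{K}) : \mathbf{K}\subset\mathbb{S}^d \text{ is a convex body of constant width } r\};$$ (iii) every wide $r$-ball body of volume $c_{BL}(r,d)$ is a convex body of constant width $r$. -/

import Mathlib

open MeasureTheory

/-- The unit sphere `𝕊^d` of the `(d+1)`-dimensional Euclidean space. -/
abbrev SphereD (d : ℕ) : Type :=
  Metric.sphere (0 : EuclideanSpace ℝ (Fin (d + 1))) 1

/-- The spherical (geodesic) distance of two points of `𝕊^d`, that is, the angle between the two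
unit vectors; it is `0` for equal points and `π` for antipodes. -/
noncomputable def distS {d : ℕ} (x y : SphereD d) : ℝ :=
  InnerProductGeometry.angle (x : EuclideanSpace ℝ (Fin (d + 1))) y

/-- The closed spherical ball with center `x` and spherical radius `r`. -/
def closedBallS {d : ℕ} (x : SphereD d) (r : ℝ) : Set (SphereD d) :=
  {y | distS x y ≤ r}

/-- The intersection of the closed spherical balls of radius `r` centered at the points of `X`. -/
def ballInter {d : ℕ} (X : Set (SphereD d)) (r : ℝ) : Set (SphereD d) :=
  ⋂ x ∈ X, closedBallS x r

/-- The spherical diameter: the supremum of the spherical distances of pairs of points. All these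
distances lie in `[0, π]`, so the supremum is a genuine one for every nonempty set. -/
noncomputable def diamS {d : ℕ} (X : Set (SphereD d)) : ℝ :=
  sSup {t | ∃ x ∈ X, ∃ y ∈ X, t = distS x y}

/-- `K` is a convex body of constant width `w` in `𝕊^d`: a closed set of spherical diameter `w`,
`0 < w ≤ π / 2`, which is the intersection of the closed balls of radius `w` centered at
its points. -/
structure IsConstantWidthBody {d : ℕ} (w : ℝ) (K : Set (SphereD d)) : Prop where
  pos : 0 < w
  le_pi_div_two : w ≤ Real.pi / 2
  isClosed : IsClosed K
  diam_eq : diamS K = w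
  eq_ballInter : K = ballInter K w

/-- `W` is a wide `r`-ball body: `W` is the intersection of the closed balls of radius `r` centered
at the points of a nonempty closed set of spherical diameter at most `r`. -/
def IsWideBallBody {d : ℕ} (r : ℝ) (W : Set (SphereD d)) : Prop :=
  ∃ X : Set (SphereD d), X.Nonempty ∧ IsClosed X ∧ diamS X ≤ r ∧ W = ballInter X r

/-- The `d`-dimensional spherical volume (surface measure) on `𝕊^d`. -/
noncomputable def volS {d : ℕ} (K : Set (SphereD d)) : ENNReal :=
  (volume : Measure (EuclideanSpace ℝ (Fin (d + 1)))).toSphere K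

/-- The infimum of the volumes of the wide `r`-ball bodies of `𝕊^d`. -/
noncomputable def cBL (r : ℝ) (d : ℕ) : ENNReal :=
  sInf {v | ∃ W : Set (SphereD d), IsWideBallBody r W ∧ v = volS W}

open Filter Topology Set
open scoped Pointwise

/-! Enlarging `X` shrinks B[X, r]. By Zorn, `X` lies in a maximal set `Y` of diameter at most `r`;
maximality gives Y = B[Y, r], hence Y ⊆ B[X, r], and connectedness of the sphere forces the diameter
to be exactly `r`. This is (i).

Bodies of constant width are themselves wide, so (ii) only needs a wide body attaining the infimum:
generating sets of a minimizing sequence subconverge in the Hausdorff metric, and the volume of B[X,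
r] is lower semicontinuous in `X`.

For (iii), a minimizer contains a constant width body of the same volume. The cone over a wide body
is convex with nonempty interior, as 0 ≤ cos r < 1, so a closed subset of full volume is everything.
-/

theorem distS_le_iff {d : ℕ} {r : ℝ} (hr0 : 0 ≤ r) (hr : r ≤ Real.pi) (x y : SphereD d) :
    distS x y ≤ r ↔ Real.cos r ≤ inner ℝ (x : EuclideanSpace ℝ (Fin (d + 1))) y := by
  have hx : ‖(x : EuclideanSpace ℝ (Fin (d + 1)))‖ = 1 := by simp
  have hy : ‖(y : EuclideanSpace ℝ (Fin (d + 1)))‖ = 1 := by simp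
  have h : inner ℝ (x : EuclideanSpace ℝ (Fin (d + 1))) y = Real.cos (distS x y) := by
    rw [distS, InnerProductGeometry.cos_angle, hx, hy]; simp
  rw [h]
  exact (Real.strictAntiOn_cos.le_iff_ge ⟨hr0, hr⟩
    ⟨InnerProductGeometry.angle_nonneg _ _, InnerProductGeometry.angle_le_pi _ _⟩).symm

theorem mem_ballInter_iff {d : ℕ} {r : ℝ} (hr0 : 0 ≤ r) (hr : r ≤ Real.pi)
    {X : Set (SphereD d)} {y : SphereD d} :
    y ∈ ballInter X r ↔
      ∀ x ∈ X, Real.cos r ≤ inner ℝ (x : EuclideanSpace ℝ (Fin (d + 1))) y := by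
  simp [ballInter, closedBallS, distS_le_iff hr0 hr]

theorem distS_le_diamS {d : ℕ} {X : Set (SphereD d)} {x y : SphereD d} (hx : x ∈ X)
    (hy : y ∈ X) : distS x y ≤ diamS X := by
  refine le_csSup ⟨Real.pi, ?_⟩ ⟨x, hx, y, hy, rfl⟩
  rintro _ ⟨a, -, b, -, rfl⟩
  exact InnerProductGeometry.angle_le_pi _ _

theorem diamS_nonneg {d : ℕ} (X : Set (SphereD d)) : 0 ≤ diamS X := by
  refine Real.sSup_nonneg ?_
  rintro _ ⟨a, -, b, -, rfl⟩
  exact InnerProductGeometry.angle_nonneg _ _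

theorem diamS_le_iff {d : ℕ} {r : ℝ} (hr0 : 0 ≤ r) (hr : r ≤ Real.pi) {X : Set (SphereD d)} :
    diamS X ≤ r ↔ ∀ x ∈ X, ∀ y ∈ X,
      Real.cos r ≤ inner ℝ (x : EuclideanSpace ℝ (Fin (d + 1))) y := by
  constructor
  · intro h x hx y hy
    exact (distS_le_iff hr0 hr x y).1 ((distS_le_diamS hx hy).trans h)
  · intro h
    refine Real.sSup_le ?_ hr0
    rintro _ ⟨x, hx, y, hy, rfl⟩
    exact (distS_le_iff hr0 hr x y).2 (h x hx y hy)

/-- Inner products of unit vectors are `1`-Lipschitz in each argument. -/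
theorem abs_inner_sub_inner_le {d : ℕ} (x y z : SphereD d) :
    |inner ℝ (x : EuclideanSpace ℝ (Fin (d + 1))) y -
      inner ℝ (x : EuclideanSpace ℝ (Fin (d + 1))) z| ≤ dist y z := by
  rw [← inner_sub_right, Subtype.dist_eq, dist_eq_norm]
  refine (abs_real_inner_le_norm _ _).trans ?_
  simp

/-! ### Spherical intersections and their convex cones -/

/-- The set of points whose inner product with every point of `X` is at least `c`. -/
def capInter {d : ℕ} (X : Set (SphereD d)) (c : ℝ) : Set (SphereD d) :=
  {y | ∀ x ∈ X, c ≤ inner ℝ (x : EuclideanSpace ℝ (Fin (d + 1))) y}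

theorem ballInter_eq_capInter {d : ℕ} {r : ℝ} (hr0 : 0 ≤ r) (hr : r ≤ Real.pi)
    (X : Set (SphereD d)) : ballInter X r = capInter X (Real.cos r) :=
  Set.ext fun _ => mem_ballInter_iff hr0 hr

theorem isClosed_capInter {d : ℕ} (X : Set (SphereD d)) (c : ℝ) : IsClosed (capInter X c) := by
  have : capInter X c =
      ⋂ x ∈ X, {y : SphereD d | c ≤ inner ℝ (x : EuclideanSpace ℝ (Fin (d + 1))) y} := by
    ext; simp [capInter]
  rw [this]
  exact isClosed_biInter fun x _ => isClosed_le continuous_const (by fun_prop)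

/-- The cone over `capInter X c`. -/
def capCone {d : ℕ} (X : Set (SphereD d)) (c : ℝ) : Set (EuclideanSpace ℝ (Fin (d + 1))) :=
  {z | ∀ x ∈ X, c * ‖z‖ ≤ inner ℝ (x : EuclideanSpace ℝ (Fin (d + 1))) z}

theorem smul_mem_capCone {d : ℕ} {X : Set (SphereD d)} {c t : ℝ} (ht : 0 ≤ t) {y : SphereD d}
    (hy : y ∈ capInter X c) : t • (y : EuclideanSpace ℝ (Fin (d + 1))) ∈ capCone X c := by
  intro x hx
  have := mul_le_mul_of_nonneg_left (hy x hx) ht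
  rw [norm_smul, inner_smul_right, Real.norm_of_nonneg ht, norm_eq_of_mem_sphere]
  linarith

/-- For `c ≥ 0` the function `c * ‖z‖` is convex, so each constraint cuts out a convex circular
cone. This is where `r ≤ π / 2` enters. -/
theorem convex_capCone {d : ℕ} (X : Set (SphereD d)) {c : ℝ} (hc : 0 ≤ c) :
    Convex ℝ (capCone X c) := by
  intro z hz w hw a b ha hb _ x hx
  rw [inner_add_right, inner_smul_right, inner_smul_right]
  have h1 : ‖a • z + b • w‖ ≤ a * ‖z‖ + b * ‖w‖ := by
    refine (norm_add_le _ _).trans ?_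
    rw [norm_smul, norm_smul, Real.norm_of_nonneg ha, Real.norm_of_nonneg hb]
  nlinarith [mul_le_mul_of_nonneg_left h1 hc, mul_le_mul_of_nonneg_left (hz x hx) ha,
    mul_le_mul_of_nonneg_left (hw x hx) hb]

/-- A point at which one of the inequalities defining `capCone X c` is an equality is not an
interior point. -/
theorem notMem_interior_capCone {d : ℕ} {X : Set (SphereD d)} {c : ℝ} (hc0 : 0 ≤ c) (hc1 : c < 1)
    {z : EuclideanSpace ℝ (Fin (d + 1))} {x : SphereD d} (hx : x ∈ X)
    (h : inner ℝ (x : EuclideanSpace ℝ (Fin (d + 1))) z = c * ‖z‖) :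
    z ∉ interior (capCone X c) := by
  intro hz
  -- Moving from `z` by `-t • x` lowers the inner product by `t` but `c * ‖·‖` by at most `c * t <
  -- t`, which breaks the tight constraint.
  have hlim : Tendsto (fun t : ℝ => z - t • (x : EuclideanSpace ℝ (Fin (d + 1))))
      (𝓝[>] 0) (𝓝 z) := by
    have : Continuous fun t : ℝ => z - t • (x : EuclideanSpace ℝ (Fin (d + 1))) := by fun_prop
    simpa using (this.tendsto 0).mono_left nhdsWithin_le_nhds
  obtain ⟨t, ht, ht0⟩ := ((hlim.eventually (mem_interior_iff_mem_nhds.1 hz)).and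
    self_mem_nhdsWithin).exists
  have ht0 : 0 < t := ht0
  have h1 := ht x hx
  rw [inner_sub_right, inner_smul_right, real_inner_self_eq_norm_sq, norm_eq_of_mem_sphere, h]
    at h1
  have h2 : ‖z‖ - t ≤ ‖z - t • (x : EuclideanSpace ℝ (Fin (d + 1)))‖ := by
    have := norm_sub_norm_le z (t • (x : EuclideanSpace ℝ (Fin (d + 1))))
    rwa [norm_smul, norm_eq_of_mem_sphere, Real.norm_of_nonneg ht0.le, mul_one] at this
  nlinarith [mul_le_mul_of_nonneg_left h2 hc0, mul_lt_mul_of_pos_right hc1 ht0]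

theorem volS_eq {d : ℕ} {s : Set (SphereD d)} (hs : MeasurableSet s) :
    volS s = (d + 1 : ℕ) *
      volume (Ioo (0 : ℝ) 1 • (Subtype.val '' s : Set (EuclideanSpace ℝ (Fin (d + 1))))) := by
  rw [volS, Measure.toSphere_apply' _ hs, finrank_euclideanSpace_fin]

/-- The strict inner parallel sets of `capInter X c` exhaust it up to a null set. -/
theorem volS_capInter_diff_iUnion {d : ℕ} {X : Set (SphereD d)} (hX : IsCompact X) {c : ℝ}
    (hc0 : 0 ≤ c) (hc1 : c < 1) :
    volS (capInter X c \ ⋃ k : ℕ, capInter X (c + 1 / ((k : ℝ) + 1))) = 0 := by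
  have hm : MeasurableSet (capInter X c \ ⋃ k : ℕ, capInter X (c + 1 / ((k : ℝ) + 1))) :=
    (isClosed_capInter X c).measurableSet.diff
      (MeasurableSet.iUnion fun k => (isClosed_capInter X _).measurableSet)
  rw [volS_eq hm, mul_eq_zero]
  right
  -- A missed point has a tight constraint, by compactness of `X`, so its ray lies in the frontier
  -- of a convex set, which is null.
  refine measure_mono_null ?_ ((convex_capCone X hc0).addHaar_frontier volume)
  rintro _ ⟨t, ht, _, ⟨y, ⟨hy, hy'⟩, rfl⟩, rfl⟩
  refine ⟨subset_closure (smul_mem_capCone ht.1.le hy), ?_⟩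
  rcases X.eq_empty_or_nonempty with rfl | hne
  · exact (hy' (mem_iUnion.2 ⟨0, by simp [capInter]⟩)).elim
  obtain ⟨x, hx, hmin⟩ := hX.exists_isMinOn hne (f := fun x : SphereD d =>
    inner ℝ (x : EuclideanSpace ℝ (Fin (d + 1))) (y : EuclideanSpace ℝ (Fin (d + 1))))
    (by fun_prop)
  have hxy : inner ℝ (x : EuclideanSpace ℝ (Fin (d + 1))) y = c := by
    by_contra hne
    have hlt := lt_of_le_of_ne (hy x hx) (Ne.symm hne)
    obtain ⟨k, hk⟩ := exists_nat_one_div_lt (sub_pos.2 hlt)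
    refine hy' (mem_iUnion.2 ⟨k, fun x' hx' => ?_⟩)
    have : inner ℝ (x : EuclideanSpace ℝ (Fin (d + 1))) (y : EuclideanSpace ℝ (Fin (d + 1)))
      ≤ inner ℝ (x' : EuclideanSpace ℝ (Fin (d + 1))) y := hmin hx'
    linarith
  refine notMem_interior_capCone hc0 hc1 hx ?_
  simp only [inner_smul_right, norm_smul, norm_eq_of_mem_sphere]
  rw [hxy, Real.norm_of_nonneg ht.1.le]; ring

/-! ### Hausdorff limits -/

/-- Lower semicontinuity of the volume of `capInter` for the Hausdorff distance. -/
theorem volS_capInter_le_of_tendsto {d : ℕ} {c : ℝ} (hc0 : 0 ≤ c) (hc1 : c < 1)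
    {X : ℕ → TopologicalSpace.NonemptyCompacts (SphereD d)}
    {Z : TopologicalSpace.NonemptyCompacts (SphereD d)} (hX : Tendsto X atTop (𝓝 Z))
    {v : ENNReal} (hv : Tendsto (fun n => volS (capInter (X n : Set (SphereD d)) c)) atTop (𝓝 v)) :
    volS (capInter (Z : Set (SphereD d)) c) ≤ v := by
  have hle : volS (capInter (Z : Set (SphereD d)) c) ≤
      volS (⋃ k : ℕ, capInter (Z : Set (SphereD d)) (c + 1 / ((k : ℝ) + 1))) := by
    have h0 := volS_capInter_diff_iUnion Z.isCompact hc0 hc1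
    unfold volS at h0 ⊢
    exact measure_mono_ae (ae_le_set.2 h0)
  refine hle.trans ?_
  have hmono : Monotone fun k : ℕ =>
      capInter (Z : Set (SphereD d)) (c + 1 / ((k : ℝ) + 1)) := by
    intro k l hkl y hy x hx
    have := hy x hx
    have := Nat.one_div_le_one_div (α := ℝ) hkl
    linarith
  unfold volS at hv ⊢
  rw [hmono.measure_iUnion]
  refine iSup_le fun k => ge_of_tendsto hv ?_
  have hk : (0 : ℝ) < 1 / ((k : ℝ) + 1) := Nat.one_div_pos_of_nat
  obtain ⟨N, hN⟩ := Metric.tendsto_atTop.1 hX _ hk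
  filter_upwards [eventually_ge_atTop N] with n hNn
  have hn := hN n hNn
  -- The slack `1 / (k + 1)` absorbs the Hausdorff displacement between `X n` and `Z`.
  refine measure_mono fun y hy x hx => ?_
  rw [Metric.NonemptyCompacts.dist_eq] at hn
  obtain ⟨z, hz, hxz⟩ := Metric.exists_dist_lt_of_hausdorffDist_lt hx hn
    (Metric.hausdorffEDist_ne_top_of_nonempty_of_bounded (X n).nonempty Z.nonempty
      (X n).isCompact.isBounded Z.isCompact.isBounded)
  have h1 := hy z hz
  have h2 := abs_le.1 (abs_inner_sub_inner_le y x z)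
  rw [real_inner_comm (x : EuclideanSpace ℝ (Fin (d + 1))), real_inner_comm
    (z : EuclideanSpace ℝ (Fin (d + 1)))] at h2
  linarith [h2.1]

/-- A lower bound for pairwise inner products passes to limits in the Hausdorff distance. -/
theorem le_inner_of_tendsto {d : ℕ} {c : ℝ}
    {X : ℕ → TopologicalSpace.NonemptyCompacts (SphereD d)}
    {Z : TopologicalSpace.NonemptyCompacts (SphereD d)} (hX : Tendsto X atTop (𝓝 Z))
    (h : ∀ n, ∀ x ∈ X n, ∀ y ∈ X n, c ≤ inner ℝ (x : EuclideanSpace ℝ (Fin (d + 1))) y) :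
    ∀ x ∈ Z, ∀ y ∈ Z, c ≤ inner ℝ (x : EuclideanSpace ℝ (Fin (d + 1))) y := by
  intro x hx y hy
  refine le_of_forall_pos_le_add fun ε hε => ?_
  obtain ⟨N, hN⟩ := Metric.tendsto_atTop.1 hX (ε / 2) (by positivity)
  have hn := hN N le_rfl
  rw [dist_comm, Metric.NonemptyCompacts.dist_eq] at hn
  have hfin := Metric.hausdorffEDist_ne_top_of_nonempty_of_bounded Z.nonempty (X N).nonempty
      Z.isCompact.isBounded (X N).isCompact.isBounded
  obtain ⟨x', hx', hxx⟩ := Metric.exists_dist_lt_of_hausdorffDist_lt hx hn hfin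
  obtain ⟨y', hy', hyy⟩ := Metric.exists_dist_lt_of_hausdorffDist_lt hy hn hfin
  have h0 := h N x' hx' y' hy'
  have h1 := abs_le.1 (abs_inner_sub_inner_le x y y')
  have h2 := abs_le.1 (abs_inner_sub_inner_le y' x x')
  rw [real_inner_comm (x : EuclideanSpace ℝ (Fin (d + 1))), real_inner_comm
    (x' : EuclideanSpace ℝ (Fin (d + 1)))] at h2
  linarith [h1.1, h2.1]

/-! ### Closed subsets of full volume -/

/-- The cone `capCone X c` of a set of diameter at most `arccos c` has interior points. -/
theorem interior_capCone_nonempty {d : ℕ} {X : Set (SphereD d)} (hX : IsCompact X)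
    (hne : X.Nonempty) {c : ℝ} (hc0 : 0 ≤ c) (hc1 : c < 1)
    (h : ∀ x ∈ X, ∀ y ∈ X, c ≤ inner ℝ (x : EuclideanSpace ℝ (Fin (d + 1))) y) :
    (interior (capCone X c)).Nonempty := by
  obtain ⟨t, htX, hfin, hcover⟩ := hX.finite_cover_balls (sub_pos.2 hc1)
  lift t to Finset (SphereD d) using hfin
  -- Each point of the net contributes at least `c` to the inner product of `x` with `z`; one within
  -- `1 - c` of `x` contributes more. Hence the total exceeds `c * t.card ≥ c * ‖z‖`.
  set z : EuclideanSpace ℝ (Fin (d + 1)) := ∑ x ∈ t, (x : EuclideanSpace ℝ (Fin (d + 1))) with hz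
  have hznorm : ‖z‖ ≤ t.card := by
    refine (norm_sum_le _ _).trans ?_
    simp
  have hpos : ∀ x ∈ X, 0 < inner ℝ (x : EuclideanSpace ℝ (Fin (d + 1))) z - c * ‖z‖ := by
    intro x hx
    obtain ⟨y, hy, hxy⟩ := mem_iUnion₂.1 (hcover hx)
    have hlt : ∑ _x ∈ t, c < inner ℝ (x : EuclideanSpace ℝ (Fin (d + 1))) z := by
      rw [hz, inner_sum]
      refine Finset.sum_lt_sum (fun w hw => h x hx w (htX hw)) ⟨y, hy, ?_⟩
      have h1 := abs_le.1 (abs_inner_sub_inner_le x x y)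
      rw [real_inner_self_eq_norm_sq, norm_eq_of_mem_sphere] at h1
      have := Metric.mem_ball.1 hxy
      linarith [h1.2]
    rw [Finset.sum_const, nsmul_eq_mul] at hlt
    nlinarith [mul_le_mul_of_nonneg_left hznorm hc0]
  obtain ⟨x₀, hx₀, hmin⟩ := hX.exists_isMinOn hne (f := fun x : SphereD d =>
    inner ℝ (x : EuclideanSpace ℝ (Fin (d + 1))) z - c * ‖z‖) (by fun_prop)
  set δ := inner ℝ (x₀ : EuclideanSpace ℝ (Fin (d + 1))) z - c * ‖z‖ with hδ
  have hδ0 : 0 < δ := hpos x₀ hx₀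
  refine ⟨z, mem_interior_iff_mem_nhds.2 ?_⟩
  filter_upwards [Metric.ball_mem_nhds z (half_pos hδ0)] with w hw x hx
  rw [Metric.mem_ball, dist_eq_norm] at hw
  have h1 : δ ≤ inner ℝ (x : EuclideanSpace ℝ (Fin (d + 1))) z - c * ‖z‖ := hmin hx
  have h2 := abs_le.1 (abs_real_inner_le_norm (x : EuclideanSpace ℝ (Fin (d + 1))) (w - z))
  rw [norm_eq_of_mem_sphere, inner_sub_right] at h2
  have h3 : ‖w‖ - ‖z‖ ≤ ‖w - z‖ := norm_sub_norm_le w z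
  nlinarith [mul_le_mul_of_nonneg_left h3 hc0, mul_le_mul_of_nonneg_right hc1.le
    (norm_nonneg (w - z)), h2.1]

/-- A closed subset of full volume in `capInter X c` is all of it. -/
theorem eq_capInter_of_volS_diff_eq_zero {d : ℕ} {X Y : Set (SphereD d)} {c : ℝ} (hc0 : 0 ≤ c)
    (hint : (interior (capCone X c)).Nonempty) (hY : IsClosed Y)
    (hYX : Y ⊆ capInter X c) (h0 : volS (capInter X c \ Y) = 0) : Y = capInter X c := by
  refine hYX.antisymm fun w hw => ?_
  by_contra hwY
  rw [volS_eq ((isClosed_capInter X c).measurableSet.diff hY.measurableSet), mul_eq_zero] at h0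
  have h0 := h0.resolve_left (by simp)
  -- Any factor in `(0, 1)` would do: `p` must lie inside the open unit ball, off the origin.
  let p : EuclideanSpace ℝ (Fin (d + 1)) := (1 / 2 : ℝ) • (w : EuclideanSpace ℝ (Fin (d + 1)))
  have hpn : ‖p‖ = 1 / 2 := by
    rw [norm_smul, norm_eq_of_mem_sphere]; norm_num
  have hYc : IsClosed (Subtype.val '' Y : Set (EuclideanSpace ℝ (Fin (d + 1)))) :=
    (hY.isCompact.image continuous_subtype_val).isClosed
  have hO : {z : EuclideanSpace ℝ (Fin (d + 1)) | 0 < ‖z‖ ∧ ‖z‖ < 1 ∧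
      ‖z‖⁻¹ • z ∉ (Subtype.val '' Y : Set (EuclideanSpace ℝ (Fin (d + 1))))} ∈ 𝓝 p := by
    have hp0 : ‖p‖ ≠ 0 := by rw [hpn]; norm_num
    have hcont : ContinuousAt (fun z : EuclideanSpace ℝ (Fin (d + 1)) => ‖z‖⁻¹ • z) p :=
      (continuous_norm.continuousAt.inv₀ hp0).smul continuousAt_id
    refine inter_mem ?_ (inter_mem ?_ ?_)
    · exact continuous_norm.continuousAt.eventually (lt_mem_nhds (by norm_num [hpn]))
    · exact continuous_norm.continuousAt.eventually (gt_mem_nhds (by norm_num [hpn]))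
    · refine hcont.eventually (hYc.isOpen_compl.mem_nhds ?_)
      beta_reduce
      rw [hpn, smul_smul]
      rintro ⟨y, hy, hyw⟩
      norm_num at hyw
      exact hwY (Subtype.ext hyw ▸ hy)
  -- A convex set with interior points lies in the closure of its interior, so the neighbourhood
  -- `hO` meets that interior in positive measure, all of it in the cone over the difference.
  have hp : p ∈ closure (interior (capCone X c)) := by
    rw [(convex_capCone X hc0).closure_interior_eq_closure_of_nonempty_interior hint]
    exact subset_closure (smul_mem_capCone (by norm_num) hw)
  obtain ⟨q, hq1, hq2⟩ := mem_closure_iff_nhds.1 hp _ (interior_mem_nhds.2 hO)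
  refine (Measure.measure_pos_of_mem_nhds volume (inter_mem
    (isOpen_interior.mem_nhds hq1) (isOpen_interior.mem_nhds hq2))).ne' (measure_mono_null ?_ h0)
  rintro z ⟨hz1, hz2⟩
  obtain ⟨hz0, hzlt, hzY⟩ := interior_subset hz1
  have hz2 := interior_subset hz2
  have hu : ‖z‖⁻¹ • z ∈ Metric.sphere (0 : EuclideanSpace ℝ (Fin (d + 1))) 1 := by
    rw [mem_sphere_zero_iff_norm, norm_smul, norm_inv, norm_norm, inv_mul_cancel₀ hz0.ne']
  refine ⟨‖z‖, ⟨hz0, hzlt⟩, ‖z‖⁻¹ • z, ⟨⟨_, hu⟩, ⟨fun x hx => ?_, fun hy => hzY ⟨_, hy, rfl⟩⟩, rfl⟩,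
    ?_⟩
  · rw [inner_smul_right, inv_mul_eq_div, le_div_iff₀ hz0]
    exact hz2 x hx
  · simp only [smul_smul]
    rw [mul_inv_cancel₀ hz0.ne', one_smul]

/-! ### Completion to constant width -/

/-- Every set of spherical diameter at most `r` lies in a body of constant width `r`. -/
theorem exists_isConstantWidthBody_superset {d : ℕ} (hd : 1 ≤ d) {r : ℝ} (hr0 : 0 < r)
    (hr : r ≤ Real.pi / 2) {X : Set (SphereD d)} (hne : X.Nonempty) (hX : diamS X ≤ r) :
    ∃ Y, IsConstantWidthBody r Y ∧ X ⊆ Y := by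
  have hrpi : r ≤ Real.pi := by linarith [Real.pi_pos]
  obtain ⟨Y, hXY, hY⟩ := zorn_subset_nonempty {Y : Set (SphereD d) | diamS Y ≤ r} (by
    intro C hC hchain hCne
    refine ⟨⋃₀ C, ?_, fun s hs => subset_sUnion_of_mem hs⟩
    rw [mem_ofPred_eq, diamS_le_iff hr0.le hrpi]
    rintro x ⟨s, hs, hx⟩ y ⟨s', hs', hy⟩
    rcases hchain.total hs hs' with h | h
    · exact (diamS_le_iff hr0.le hrpi).1 (hC hs') x (h hx) y hy
    · exact (diamS_le_iff hr0.le hrpi).1 (hC hs) x hx y (h hy)) X hX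
  have hYr := hY.prop
  have hYr' := (diamS_le_iff hr0.le hrpi).1 hYr
  have hYeq : Y = capInter Y (Real.cos r) := by
    refine Subset.antisymm (fun y hy x hx => hYr' x hx y hy) fun z hz => ?_
    refine hY.le_of_ge (y := insert z Y) ?_ (subset_insert z Y) (mem_insert z Y)
    rw [mem_ofPred_eq, diamS_le_iff hr0.le hrpi]
    rintro x (rfl | hx) y (rfl | hy)
    · rw [real_inner_self_eq_norm_sq, norm_eq_of_mem_sphere]; simpa using Real.cos_le_one r
    · rw [real_inner_comm]; exact hz y hy
    · exact hz x hx
    · exact hYr' x hx y hy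
  have hYcl : IsClosed Y := hYeq ▸ isClosed_capInter Y _
  refine ⟨Y, ⟨hr0, hr, hYcl, ?_, ?_⟩, hXY⟩
  · by_contra hdiam
    have hlt : diamS Y < r := lt_of_le_of_ne hYr hdiam
    have hcos : Real.cos r < Real.cos (diamS Y) :=
      Real.cos_lt_cos_of_nonneg_of_le_pi (diamS_nonneg Y) hrpi hlt
    have hYs := (diamS_le_iff (diamS_nonneg Y) (hlt.le.trans hrpi)).1 (le_refl (diamS Y))
    -- If the diameter were smaller than `r`, the slack would make `Y` open as well as closed, hence
    -- the whole sphere, which contains antipodes.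
    have hopen : IsOpen Y := by
      rw [Metric.isOpen_iff]
      refine fun y hy => ⟨_, sub_pos.2 hcos, fun z hz => ?_⟩
      rw [hYeq]
      intro x hx
      have h1 := hYs x hx y hy
      have h2 := abs_le.1 (abs_inner_sub_inner_le x z y)
      have h3 := Metric.mem_ball.1 hz
      linarith [h2.1]
    have hrank : 1 < Module.rank ℝ (EuclideanSpace ℝ (Fin (d + 1))) := by
      rw [← Module.finrank_eq_rank, finrank_euclideanSpace_fin]
      exact_mod_cast Nat.lt_succ_of_le hd
    have : PreconnectedSpace (SphereD d) :=
      isPreconnected_iff_preconnectedSpace.1 (isPreconnected_sphere hrank 0 1)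
    have huniv : Y = univ := IsClopen.eq_univ ⟨hYcl, hopen⟩ (hne.mono hXY)
    obtain ⟨x, -⟩ := hne
    have := hYr' x (huniv ▸ mem_univ _) (-x) (huniv ▸ mem_univ _)
    rw [coe_neg_sphere, inner_neg_right, real_inner_self_eq_norm_sq, norm_eq_of_mem_sphere] at this
    linarith [Real.cos_nonneg_of_mem_Icc (x := r) ⟨by linarith, hr⟩]
  · rw [ballInter_eq_capInter hr0.le hrpi]; exact hYeq

theorem IsWideBallBody.exists_isConstantWidthBody_subset {d : ℕ} (hd : 1 ≤ d) {r : ℝ}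
    (hr0 : 0 < r) (hr : r ≤ Real.pi / 2) {W : Set (SphereD d)} (hW : IsWideBallBody r W) :
    ∃ Y, IsConstantWidthBody r Y ∧ Y ⊆ W := by
  obtain ⟨X, hne, -, hX, rfl⟩ := hW
  obtain ⟨Y, hY, hXY⟩ := exists_isConstantWidthBody_superset hd hr0 hr hne hX
  refine ⟨Y, hY, ?_⟩
  conv_lhs => rw [hY.eq_ballInter]
  exact biInter_subset_biInter_left hXY

theorem IsConstantWidthBody.isWideBallBody {d : ℕ} {r : ℝ} {K : Set (SphereD d)}
    (hK : IsConstantWidthBody r K) : IsWideBallBody r K := by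
  refine ⟨K, nonempty_iff_ne_empty.2 ?_, hK.isClosed, hK.diam_eq.le, hK.eq_ballInter⟩
  rintro rfl
  have := hK.diam_eq
  have := hK.pos
  simp [diamS] at *
  linarith

theorem cBL_le_volS {d : ℕ} {r : ℝ} {W : Set (SphereD d)} (hW : IsWideBallBody r W) :
    cBL r d ≤ volS W :=
  sInf_le ⟨W, hW, rfl⟩

/-! ### Existence of minimizers and conclusion -/

/-- The infimum of the volumes of the wide ball bodies is attained. -/
theorem exists_isWideBallBody_volS_le_cBL {d : ℕ} {r : ℝ} (hr0 : 0 < r) (hr : r ≤ Real.pi / 2) :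
    ∃ W : Set (SphereD d), IsWideBallBody r W ∧ volS W ≤ cBL r d := by
  have hrpi : r ≤ Real.pi := by linarith [Real.pi_pos]
  have hc0 : 0 ≤ Real.cos r := Real.cos_nonneg_of_mem_Icc ⟨by linarith, hr⟩
  have hc1 : Real.cos r < 1 := by
    simpa using Real.cos_lt_cos_of_nonneg_of_le_pi le_rfl hrpi hr0
  have hne : {v | ∃ W : Set (SphereD d), IsWideBallBody r W ∧ v = volS W}.Nonempty := by
    obtain ⟨x, hx⟩ := (NormedSpace.sphere_nonempty
      (x := (0 : EuclideanSpace ℝ (Fin (d + 1)))) (r := 1)).2 zero_le_one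
    refine ⟨_, _, ⟨{⟨x, hx⟩}, singleton_nonempty _, isClosed_singleton, ?_, rfl⟩, rfl⟩
    rw [diamS_le_iff hr0.le hrpi]
    rintro _ rfl _ rfl
    rw [real_inner_self_eq_norm_sq, norm_eq_of_mem_sphere]; simpa using hc1.le
  obtain ⟨u, -, hu, hmem⟩ := exists_seq_tendsto_sInf hne (OrderBot.bddBelow _)
  choose W hW huW using hmem
  choose X hXne hXcl hXd hWX using hW
  let Q : ℕ → TopologicalSpace.NonemptyCompacts (SphereD d) := fun n =>
    ⟨⟨X n, (hXcl n).isCompact⟩, hXne n⟩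
  -- Blaschke selection, applied to the generating sets rather than to the bodies.
  obtain ⟨Z, φ, hφ, hZ⟩ := CompactSpace.tendsto_subseq Q
  refine ⟨ballInter (Z : Set (SphereD d)) r, ⟨Z, Z.nonempty, Z.isCompact.isClosed, ?_, rfl⟩, ?_⟩
  · rw [diamS_le_iff hr0.le hrpi]
    exact le_inner_of_tendsto hZ fun n => (diamS_le_iff hr0.le hrpi).1 (hXd (φ n))
  · rw [ballInter_eq_capInter hr0.le hrpi]
    refine volS_capInter_le_of_tendsto hc0 hc1 hZ ((hu.comp hφ.tendsto_atTop).congr fun n => ?_)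
    simp only [Function.comp_apply]
    rw [huW, hWX, ballInter_eq_capInter hr0.le hrpi]
    rfl

theorem proposition4 (d : ℕ) (hd : 2 ≤ d) (r : ℝ) (hr0 : 0 < r) (hr : r ≤ Real.pi / 2) :
    (∀ W : Set (SphereD d), IsWideBallBody r W →
      ∃ Y : Set (SphereD d), IsConstantWidthBody r Y ∧ Y ⊆ W) ∧
    IsLeast {v : ENNReal | ∃ K : Set (SphereD d), IsConstantWidthBody r K ∧ v = volS K}
      (cBL r d) ∧
    (∀ W : Set (SphereD d), IsWideBallBody r W → volS W = cBL r d →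
      IsConstantWidthBody r W) := by
  have hd1 : 1 ≤ d := by omega
  have hrpi : r ≤ Real.pi := by linarith [Real.pi_pos]
  have hc0 : 0 ≤ Real.cos r := Real.cos_nonneg_of_mem_Icc ⟨by linarith, hr⟩
  have hc1 : Real.cos r < 1 := by
    simpa using Real.cos_lt_cos_of_nonneg_of_le_pi le_rfl hrpi hr0
  refine ⟨fun W hW => hW.exists_isConstantWidthBody_subset hd1 hr0 hr, ⟨?_, ?_⟩, ?_⟩
  · obtain ⟨W, hW, hvol⟩ := exists_isWideBallBody_volS_le_cBL (d := d) hr0 hr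
    obtain ⟨Y, hY, hYW⟩ := hW.exists_isConstantWidthBody_subset hd1 hr0 hr
    exact ⟨Y, hY, (cBL_le_volS hY.isWideBallBody).antisymm ((measure_mono hYW).trans hvol)⟩
  · rintro _ ⟨K, hK, rfl⟩
    exact cBL_le_volS hK.isWideBallBody
  · intro W hW hvol
    obtain ⟨Y, hY, hYW⟩ := hW.exists_isConstantWidthBody_subset hd1 hr0 hr
    obtain ⟨X, hne, hXcl, hX, rfl⟩ := hW
    rw [ballInter_eq_capInter hr0.le hrpi] at hvol hYW ⊢
    have hdiff : volS (capInter X (Real.cos r) \ Y) = 0 := by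
      have hle := hvol.le.trans (cBL_le_volS hY.isWideBallBody)
      unfold volS at hle ⊢
      rw [measure_sdiff hYW hY.isClosed.measurableSet.nullMeasurableSet (measure_ne_top _ _)]
      exact tsub_eq_zero_of_le hle
    rwa [← eq_capInter_of_volS_diff_eq_zero hc0 (interior_capCone_nonempty hXcl.isCompact hne hc0
      hc1 ((diamS_le_iff hr0.le hrpi).1 hX)) hY.isClosed hYW hdiff]
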